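/- **Setting.** Let $\{0,1\}^{\mathbb N}$ be Cantor space with the product topology, let $\{0,1\}^{\mathbb N}_c$ be its subspace of computable sequences, and let $x{\restriction}n$ denote the first $n$ bits of $x$. For a finite string $u$ let $[u]$ be the set of infinite extensions of $u$. A *monotone machine* is a c.e. set $M$ of pairs $(p,u)$ of finite binary strings ("on program $p$ the machine writes at least $u$ on its one-way output tape") such that, if $(p,u),(q,v)\in M$ and $p$ is a prefix of $q$, then one of $u,v$ is a prefix of the other. Put $Km_M(u)=\min\{|p| : (p,w)\in M \text{ for some } w \text{ extending } u\}$ (and $\infty$ if there is no such $p$). The machine $M$ is *optimal* if for every monotone machine $N$ there is $d\in\mathbb N$ with $Km_M(u)\le Km_N(u)+d$ for all $u$. Optimal monotone machines exist; fix any optimal $M$ and write $Km=Km_M$ for the monotone complexity. A set $A\subseteq\{0,1\}^{\mathbb N}_c$ is *Markov-semidecidable* if there is a Turing machine which, given any program computing the bits of a computable sequence $x$, halts if and only if $x\in A$. A set $A\subseteq\{0,1\}^{\mathbb N}_c$ is $\Sigma^0_2$ (in the effective Borel hierarchy) if $A=S\cap\{0,1\}^{\mathbb N}_c$ for some $S=\bigcup_{i}(U_i\setminus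 V_i)$, where $(U_i)_{i\in\mathbb N}$ and $(V_i)_{i\in\mathbb N}$ are uniformly effectively open sequences of subsets of $\{0,1\}^{\mathbb N}$; here $(U_i)$ is uniformly effectively open if $U_i=\bigcup_{(i,u)\in W}[u]$ for some c.e. set $W\subseteq\mathbb N\times\{0,1\}^{<\mathbb N}$. **Theorem.** There is $c_0\in\mathbb N$ such that for every integer $c\ge c_0$ the set $$A=\{x\in\{0,1\}^{\mathbb N}_c : \forall n\in\mathbb N,\ Km(x{\restriction}n)<n/2+c\}$$ is Markov-semidecidable, is a non-empty closed subset of $\{0,1\}^{\mathbb N}_c$ with empty interior in $\{0,1\}^{\mathbb N}_c$, and is not $\Sigma^0_2$. -/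

import Mathlib

open scoped ENNReal

/-- Cantor space, with the product of the discrete topologies. -/
abbrev Cantor : Type := ℕ → Bool

/-- The subspace of computable points of Cantor space, with the subspace topology. -/
abbrev ComputableCantor : Type := {x : Cantor // Computable x}

/-- The finite string consisting of the first `n` bits of `x`. -/
def Cantor.take (x : Cantor) (n : ℕ) : List Bool := (List.range n).map x

/-- The set of infinite extensions of a finite string. -/
def cylinder (u : List Bool) : Set Cantor := {x | x.take u.length = u}

/-- A monotone machine: a c.e. set of pairs `(p, u)`, read as "on program `p`, the machine writes
at least the string `u` on its one-way output tape", in which the outputs written on comparable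
programs are comparable for the prefix order. -/
structure IsMonotoneMachine (M : Set (List Bool × List Bool)) : Prop where
  re : REPred (fun z : List Bool × List Bool => z ∈ M)
  compat : ∀ p q u v : List Bool, (p, u) ∈ M → (q, v) ∈ M → p <+: q → (u <+: v ∨ v <+: u)

/-- The monotone complexity of `u` relative to the machine `M`: the length of a shortest program
on which `M` writes some extension of `u` (and `⊤` if there is none). -/
noncomputable def Km (M : Set (List Bool × List Bool)) (u : List Bool) : ℕ∞ :=
  ⨅ z ∈ {z : List Bool × List Bool | z ∈ M ∧ u <+: z.2}, (z.1.length : ℕ∞)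

/-- An optimal monotone machine: its complexity is minimal, up to an additive constant, among the
complexities of all monotone machines. -/
structure IsOptimalMonotoneMachine (M : Set (List Bool × List Bool)) : Prop where
  monotone : IsMonotoneMachine M
  optimal : ∀ N : Set (List Bool × List Bool), IsMonotoneMachine N →
    ∃ d : ℕ, ∀ u : List Bool, Km M u ≤ Km N u + d

/-- `e` is a Markov-name of `x`: it is a program that computes the bits of `x`. -/
def IsMarkovName (e : Nat.Partrec.Code) (x : Cantor) : Prop :=
  ∀ n : ℕ, e.eval n = Part.some (x n).toNat

/-- `A` is Markov-semidecidable: some machine, given any Markov-name of any computable point `x`,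
halts if and only if `x` belongs to `A`. -/
def MarkovSemidecidable (A : Set ComputableCantor) : Prop :=
  ∃ H : Nat.Partrec.Code → Prop, REPred H ∧
    ∀ (x : ComputableCantor) (e : Nat.Partrec.Code), IsMarkovName e x.1 → (H e ↔ x ∈ A)

/-- A uniformly effectively open sequence of subsets of Cantor space. -/
def UniformlyEffectiveOpen (U : ℕ → Set Cantor) : Prop :=
  ∃ W : ℕ × List Bool → Prop, REPred W ∧
    ∀ i : ℕ, U i = {x | ∃ u : List Bool, W (i, u) ∧ x ∈ cylinder u}

/-- The (lightface) class `Σ⁰₂` of Cantor space: effective unions of differences of effectively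
open sets. -/
def IsSigma02 (S : Set Cantor) : Prop :=
  ∃ U V : ℕ → Set Cantor, UniformlyEffectiveOpen U ∧ UniformlyEffectiveOpen V ∧
    S = ⋃ i, U i \ V i

/-- A set of computable points is `Σ⁰₂` if it is the trace of a `Σ⁰₂` subset of Cantor space. -/
def IsSigma02OnComputable (A : Set ComputableCantor) : Prop :=
  ∃ S : Set Cantor, IsSigma02 S ∧ A = {x | x.1 ∈ S}

/-- The computable points `x` such that `Km (x ↾ n) < n / 2 + c` for all `n`. -/
def lowComplexitySet (M : Set (List Bool × List Bool)) (c : ℕ) : Set ComputableCantor :=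
  {x | ∀ n : ℕ, (Km M (x.1.take n) : ℝ≥0∞) < (n : ℝ≥0∞) / 2 + (c : ℝ≥0∞)}

namespace MonotoneMachine

open Nat.Partrec (Code)

/-- Comparable programs have comparable outputs. -/
def Compat (z w : List Bool × List Bool) : Prop :=
  (z.1 <+: w.1 ∨ w.1 <+: z.1) → (z.2 <+: w.2 ∨ w.2 <+: z.2)

instance (z w : List Bool × List Bool) : Decidable (Compat z w) := by
  unfold Compat; infer_instance

/-- The pair, if any, enumerated at stage `s` by the `e`-th program. -/
def stagePair (e s : ℕ) : Option (List Bool × List Bool) :=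
  (Code.evaln s.unpair.1 (Denumerable.ofNat Code e) s.unpair.2).bind
    fun _ => Encodable.decode s.unpair.2

/-- The pairs enumerated by the `e`-th program before stage `s`, omitting those which are
incompatible with a previous one. -/
def trimmed (e : ℕ) : ℕ → List (List Bool × List Bool)
  | 0 => []
  | s + 1 => (stagePair e s).elim (trimmed e s)
      fun q => if ∀ w ∈ trimmed e s, Compat w q then q :: trimmed e s else trimmed e s

lemma prefix_primrec : PrimrecRel (fun u v : List Bool => u <+: v) := by
  have : PrimrecRel (fun u v : List Bool => v.take u.length = u) :=
    Primrec.eq.comp₂ (Primrec.list_take.comp (Primrec.list_length.comp Primrec.fst) Primrec.snd)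
      Primrec.fst
  refine this.of_eq fun u v => ?_
  rw [List.prefix_iff_eq_take, eq_comm]

lemma compat_primrec : PrimrecRel Compat := by
  have h1 : PrimrecRel (fun z w : List Bool × List Bool => z.1 <+: w.1) :=
    prefix_primrec.comp (Primrec.fst.comp Primrec.fst) (Primrec.fst.comp Primrec.snd)
  have h2 : PrimrecRel (fun z w : List Bool × List Bool => w.1 <+: z.1) :=
    prefix_primrec.comp (Primrec.fst.comp Primrec.snd) (Primrec.fst.comp Primrec.fst)
  have h3 : PrimrecRel (fun z w : List Bool × List Bool => z.2 <+: w.2) :=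
    prefix_primrec.comp (Primrec.snd.comp Primrec.fst) (Primrec.snd.comp Primrec.snd)
  have h4 : PrimrecRel (fun z w : List Bool × List Bool => w.2 <+: z.2) :=
    prefix_primrec.comp (Primrec.snd.comp Primrec.snd) (Primrec.snd.comp Primrec.fst)
  refine PrimrecPred.of_eq (((h1.or h2).not).or (h3.or h4)) fun a => ?_
  unfold Compat
  tauto

lemma stagePair_primrec : Primrec₂ stagePair := by
  have hn : Primrec fun a : ℕ × ℕ => a.2.unpair.2 :=
    Primrec.snd.comp (Primrec.unpair.comp Primrec.snd)
  have hk : Primrec fun a : ℕ × ℕ => a.2.unpair.1 :=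
    Primrec.fst.comp (Primrec.unpair.comp Primrec.snd)
  refine Primrec.option_bind
    (Code.primrec_evaln.comp ((hk.pair ((Primrec.ofNat Code).comp Primrec.fst)).pair hn)) ?_
  exact Primrec.decode.comp (hn.comp Primrec.fst)

lemma trimmed_primrec : Primrec₂ trimmed := by
  have key : Primrec₂ fun (e : ℕ) (p : ℕ × List (List Bool × List Bool)) =>
      (stagePair e p.1).elim p.2 fun q => if ∀ w ∈ p.2, Compat w q then q :: p.2 else p.2 := by
    have hl : Primrec fun x : (ℕ × (ℕ × List (List Bool × List Bool))) × (List Bool × List Bool) =>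
        x.1.2.2 := Primrec.snd.comp (Primrec.snd.comp Primrec.fst)
    refine (Primrec.option_casesOn (o := fun x : ℕ × (ℕ × List (List Bool × List Bool)) =>
        stagePair x.1 x.2.1) (f := fun x => x.2.2)
        (g := fun x q => if ∀ w ∈ x.2.2, Compat w q then q :: x.2.2 else x.2.2) ?_ ?_ ?_).of_eq ?_
    · exact stagePair_primrec.comp Primrec.fst (Primrec.fst.comp Primrec.snd)
    · exact Primrec.snd.comp Primrec.snd
    · refine Primrec.ite ?_ (Primrec.list_cons.comp Primrec.snd hl) hl
      exact compat_primrec.forall_mem_list.comp hl Primrec.snd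
    · intro x
      cases h : stagePair x.1 x.2.1 <;> simp [h]
  refine (Primrec.nat_rec (f := fun _ : ℕ => ([] : List (List Bool × List Bool)))
    (Primrec.const []) key).of_eq fun e s => ?_
  induction s with
  | zero => rfl
  | succ s ih => simp only [trimmed] at ih ⊢; rw [← ih]

lemma trimmed_mono (e : ℕ) : Monotone fun s => {z | z ∈ trimmed e s} := by
  refine monotone_nat_of_le_succ fun s z hz => ?_
  simp only [Set.mem_ofPred_eq, trimmed] at hz ⊢
  cases stagePair e s with
  | none => simpa using hz
  | some q =>
    simp only [Option.elim_some]
    split_ifs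
    · exact List.mem_cons_of_mem _ hz
    · exact hz

lemma Compat.symm {z w : List Bool × List Bool} (h : Compat z w) : Compat w z :=
  fun h' => (h h'.symm).symm

lemma trimmed_compat (e s : ℕ) : ∀ z ∈ trimmed e s, ∀ w ∈ trimmed e s, Compat z w := by
  induction s with
  | zero => simp [trimmed]
  | succ s ih =>
    simp only [trimmed]
    cases stagePair e s with
    | none => simpa using ih
    | some q =>
      simp only [Option.elim_some]
      split_ifs with h
      · intro z hz w hw
        rcases List.mem_cons.1 hz with rfl | hz <;> rcases List.mem_cons.1 hw with hw | hw
        · exact fun _ => Or.inl (hw ▸ List.prefix_refl _)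
        · exact (h _ hw).symm
        · exact hw ▸ h _ hz
        · exact ih _ hz _ hw
      · exact ih

lemma mem_trimmed_stage {e s : ℕ} {z : List Bool × List Bool} (hz : z ∈ trimmed e s) :
    ∃ t, stagePair e t = some z := by
  induction s with
  | zero => simp [trimmed] at hz
  | succ s ih =>
    simp only [trimmed] at hz
    cases h : stagePair e s with
    | none => exact ih (by simpa [h] using hz)
    | some q =>
      simp only [h, Option.elim_some] at hz
      split_ifs at hz
      · rcases List.mem_cons.1 hz with rfl | hz
        · exact ⟨s, h⟩
        · exact ih hz
      · exact ih hz

/-- The machine which on program `0ᵉ1p` simulates the `e`-th monotone machine on `p`. -/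
def universalMachine : Set (List Bool × List Bool) :=
  {z | ∃ e s p, z.1 = List.replicate e false ++ true :: p ∧ (p, z.2) ∈ trimmed e s}

lemma replicate_prefix {e f : ℕ} {p q : List Bool}
    (h : (List.replicate e false ++ true :: p) <+: (List.replicate f false ++ true :: q)) :
    e = f ∧ p <+: q := by
  induction e generalizing f with
  | zero =>
    cases f with
    | zero => simpa using h
    | succ f => simp [List.replicate_succ] at h
  | succ e ih =>
    cases f with
    | zero => simp [List.replicate_succ] at h
    | succ f =>
      simp only [List.replicate_succ, List.cons_append, List.cons_prefix_cons, true_and] at h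
      simpa using ih h

lemma rePred_exists_nat {α : Type*} [Primcodable α] {P : α → ℕ → Prop}
    (h : PrimrecRel P) : REPred fun a => ∃ n, P a n := by
  classical
  have : Partrec fun a => Nat.rfind fun n => (Part.some (decide (P a n)) : Part Bool) :=
    Partrec.rfind (h.decide.to_comp.partrec)
  refine this.dom_re.of_eq fun a => ?_
  refine Nat.rfind_dom'.trans ⟨fun ⟨n, hn, _⟩ => ⟨n, ?_⟩, fun ⟨n, hn⟩ => ⟨n, ?_, fun _ => trivial⟩⟩
  · simpa using hn
  · simpa using hn

lemma universalMachine_re : REPred fun z => z ∈ universalMachine := by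
  let D : ℕ → ℕ × ℕ × List Bool := fun n => (Encodable.decode n).getD (0, 0, [])
  have hD : Primrec D := Primrec.option_getD.comp Primrec.decode (Primrec.const _)
  have hrep : Primrec fun e : ℕ => List.replicate e false :=
    (Primrec.list_map Primrec.list_range (Primrec₂.const false)).of_eq fun e => by simp
  have h : PrimrecRel fun (z : List Bool × List Bool) (n : ℕ) =>
      z.1 = List.replicate (D n).1 false ++ true :: (D n).2.2 ∧
        ((D n).2.2, z.2) ∈ trimmed (D n).1 (D n).2.1 := by
    have hDn : Primrec fun x : (List Bool × List Bool) × ℕ => D x.2 := hD.comp Primrec.snd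
    have he := Primrec.fst.comp hDn
    have hs := Primrec.fst.comp (Primrec.snd.comp hDn)
    have hp := Primrec.snd.comp (Primrec.snd.comp hDn)
    refine PrimrecPred.and ?_ ?_
    · exact Primrec.eq.comp (Primrec.fst.comp Primrec.fst)
        (Primrec.list_append.comp (hrep.comp he)
          (Primrec.list_cons.comp (Primrec.const true) hp))
    · have hm : PrimrecRel fun (l : List (List Bool × List Bool)) b => b ∈ l :=
        ((Primrec.eq (α := List Bool × List Bool)).exists_mem_list).of_eq fun l b => by simp
      exact hm.comp (trimmed_primrec.comp he hs) (hp.pair (Primrec.snd.comp Primrec.fst))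
  refine (rePred_exists_nat h).of_eq fun z => ⟨?_, ?_⟩
  · rintro ⟨n, h1, h2⟩
    exact ⟨_, _, _, h1, h2⟩
  · rintro ⟨e, s, p, h1, h2⟩
    exact ⟨Encodable.encode (e, s, p), by simpa [D] using And.intro h1 h2⟩

lemma universalMachine_monotone : IsMonotoneMachine universalMachine := by
  refine ⟨universalMachine_re, ?_⟩
  rintro p q u v ⟨e, s, p', h1, h2⟩ ⟨f, t, q', h3, h4⟩ hpq
  simp only at h1 h2 h3 h4
  subst h1 h3
  obtain ⟨rfl, h⟩ := replicate_prefix hpq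
  exact trimmed_compat e (max s t) _ (trimmed_mono e (le_max_left s t) h2) _
    (trimmed_mono e (le_max_right s t) h4) (Or.inl h)

lemma exists_index {N : Set (List Bool × List Bool)} (hN : IsMonotoneMachine N) :
    ∃ e, ∀ z ∈ N, ∃ s, z ∈ trimmed e s := by
  obtain ⟨c, hc⟩ := Code.exists_code.1 hN.re
  have hst : ∀ t z, stagePair (Encodable.encode c) t = some z → z ∈ N := by
    intro t z h
    simp only [stagePair, Denumerable.ofNat_encode, Option.bind_eq_some_iff] at h
    obtain ⟨v, hv, hz⟩ := h
    have := Code.evaln_sound hv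
    rw [hc] at this
    simp only [hz] at this
    simp at this
    exact this.1
  have hN' : ∀ z ∈ N, ∀ w ∈ N, Compat z w := by
    rintro ⟨p, u⟩ hz ⟨q, v⟩ hw (h | h)
    · exact hN.compat _ _ _ _ hz hw h
    · exact (hN.compat _ _ _ _ hw hz h).symm
  refine ⟨Encodable.encode c, fun z hz => ?_⟩
  have : ∃ v, v ∈ c.eval (Encodable.encode z) := by
    rw [hc]
    simp [hz]
  obtain ⟨v, hv⟩ := this
  obtain ⟨k, hk⟩ := Code.evaln_complete.1 hv
  have h : stagePair (Encodable.encode c) (Nat.pair k (Encodable.encode z)) = some z := by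
    simp [stagePair, Option.mem_def.1 hk]
  refine ⟨Nat.pair k (Encodable.encode z) + 1, ?_⟩
  simp only [trimmed, h, Option.elim_some]
  rw [if_pos]
  · simp
  · intro w hw
    obtain ⟨t, ht⟩ := mem_trimmed_stage hw
    exact hN' _ (hst _ _ ht) _ hz

/-- Optimal monotone machines exist. -/
theorem exists_isOptimalMonotoneMachine : ∃ M, IsOptimalMonotoneMachine M := by
  refine ⟨universalMachine, universalMachine_monotone, fun N hN => ?_⟩
  obtain ⟨e, he⟩ := exists_index hN
  refine ⟨e + 1, fun u => ?_⟩
  by_cases hne : ({z : List Bool × List Bool | z ∈ N ∧ u <+: z.2}).Nonempty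
  · have : ∃ z ∈ {z : List Bool × List Bool | z ∈ N ∧ u <+: z.2}, Km N u = (z.1.length : ℕ∞) := by
      have hne' : Nonempty {z : List Bool × List Bool | z ∈ N ∧ u <+: z.2} := hne.to_subtype
      obtain ⟨z, hz⟩ := ENat.exists_eq_iInf
        (fun z : {z : List Bool × List Bool | z ∈ N ∧ u <+: z.2} => (z.1.1.length : ℕ∞))
      exact ⟨z.1, z.2, by rw [hz, Km, iInf_subtype]⟩
    obtain ⟨⟨p, w⟩, ⟨hz, hu⟩, hK⟩ := this
    obtain ⟨s, hs⟩ := he _ hz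
    rw [hK]
    refine (iInf₂_le (List.replicate e false ++ true :: p, w)
      ⟨⟨e, s, p, rfl, hs⟩, hu⟩).trans ?_
    simp only [List.length_append, List.length_replicate, List.length_cons]
    push_cast
    exact le_of_eq (by ring)
  · rw [Set.not_nonempty_iff_eq_empty] at hne
    simp [Km, hne]

end MonotoneMachine

/-!
A uniformly computable family of sequences `x₀, x₁, …` satisfies `Km (xₑ ↾ k) ≤ e + O(1)` for all
`e` and `k`, because `0ᵉ1` can serve as a program for `xₑ` (`exists_program`). All upper bounds on
complexity below come from this linear one, applied to differently indexed families.

*Semidecidability.* A program for `x` bounds the complexity of all prefixes of `x`, so that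
`Km (x ↾ n) < n / 2 + c` can only fail for `n` below an explicit bound; the finitely many
remaining inequalities are semidecidable (`exists_rePred_forall_isLow`).

*Topology.* The condition on each prefix is clopen, so the set is closed. The strings of length `n`
have distinct programs, and there are too few programs of length less than `n / 2 + c` to serve all
strings of length `n` in a given cylinder (`exists_not_isLow`), so the interior is empty. The
sequence of zeros belongs to the set as soon as `c` is large.

*Not `Σ⁰₂`.* The finite strings `w` with `w000…` in the set `A` form a c.e. set `D`. Suppose that
`A` is the union of the `U i \ V i`, and let `w ∈ D` with `[w] ⊆ U i`. All computable points of
`[w]` outside `A` lie in `V i`, and every cylinder contains such points. For each `j`, one can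
therefore search for an extension `w'` of `w` followed by `4j` zeros such that `[w'] ⊆ V i`. The
resulting sequence `w'000…` has complexity at most `j + O(1)`, and agrees with `w000…` up to length
`4j`, so that it belongs to `A` when `j` is large: in `[w]`, the set `V i` meets `A`
(`exists_isLowExtendable_of_compl_subset`). This turns the Baire category argument into a
computable construction: build an increasing sequence in `D`, and whenever the current cylinder is
seen to lie inside some `U i`, move on to an extension in `D` whose cylinder lies inside `V i`,
which a search is bound to find. The limit is computable, belongs to the closed set `A`, and lies
in no `U i \ V i`.
-/

/-! ### Closure properties of recursively enumerable predicates -/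

section Enumerable

variable {α β σ : Type*} [Primcodable α] [Primcodable β] [Primcodable σ]

theorem REPred.comp {p : β → Prop} (hp : REPred p) {f : α → β} (hf : Computable f) :
    REPred fun a => p (f a) :=
  Partrec.comp hp hf

theorem PrimrecPred.rePred {p : α → Prop} (hp : PrimrecPred p) : REPred p := by
  obtain ⟨_, h⟩ := hp
  exact ComputablePred.to_re ⟨_, h.to_comp⟩

/-- Kleene's normal form: a recursively enumerable predicate is the projection of a primitive
recursive relation. -/
theorem REPred.exists_primrecRel {p : α → Prop} (hp : REPred p) :
    ∃ R : α → ℕ → Prop, PrimrecRel R ∧ ∀ a, p a ↔ ∃ n, R a n := by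
  obtain ⟨c, hc⟩ := Nat.Partrec.Code.exists_code.1 hp
  refine ⟨fun a n => (c.evaln n (Encodable.encode a)).isSome = true, ?_, fun a => ?_⟩
  · refine Primrec.eq.comp (Primrec.option_isSome.comp ?_) (Primrec.const true)
    exact Nat.Partrec.Code.primrec_evaln.comp
      ((Primrec.snd.pair (Primrec.const c)).pair (Primrec.encode.comp Primrec.fst))
  · have h : p a ↔ ∃ v, v ∈ c.eval (Encodable.encode a) := by
      rw [hc]
      simp
    rw [h]
    simp only [Nat.Partrec.Code.evaln_complete, Option.isSome_iff_exists, Option.mem_def]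
    exact exists_comm

theorem REPred.and {p q : α → Prop} (hp : REPred p) (hq : REPred q) :
    REPred fun a => p a ∧ q a := by
  refine (Partrec.bind hp (g := fun a _ => Part.assert (q a) fun _ => Part.some ())
    (Partrec.comp hq Computable.fst)).dom_re.of_eq fun a => ?_
  simp [Part.assert]

theorem REPred.or {p q : α → Prop} (hp : REPred p) (hq : REPred q) :
    REPred fun a => p a ∨ q a := by
  obtain ⟨R, hR, hpR⟩ := hp.exists_primrecRel
  obtain ⟨S, hS, hqS⟩ := hq.exists_primrecRel
  refine (MonotoneMachine.rePred_exists_nat (P := fun a n => R a n ∨ S a n)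
    (PrimrecPred.or hR hS)).of_eq fun a => ?_
  rw [hpR, hqS, exists_or]

theorem REPred.exists {P : α → β → Prop} (hP : REPred fun z : α × β => P z.1 z.2) :
    REPred fun a => ∃ b, P a b := by
  obtain ⟨R, hR, hPR⟩ := hP.exists_primrecRel
  have hS : PrimrecRel fun (a : α) (m : ℕ) =>
      ∃ z ∈ ((Encodable.decode m : Option (β × ℕ)).toList), R (a, z.1) z.2 := by
    have h : PrimrecRel fun (z : β × ℕ) (a : α) => R (a, z.1) z.2 :=
      hR.comp (Primrec.snd.pair (Primrec.fst.comp Primrec.fst)) (Primrec.snd.comp Primrec.fst)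
    exact h.exists_mem_list.comp
      (Primrec.optionToList.comp (Primrec.decode.comp Primrec.snd)) Primrec.fst
  refine (MonotoneMachine.rePred_exists_nat hS).of_eq fun a => ⟨?_, ?_⟩
  · rintro ⟨m, z, -, hz⟩
    exact ⟨z.1, (hPR _).2 ⟨_, hz⟩⟩
  · rintro ⟨b, hb⟩
    obtain ⟨n, hn⟩ := (hPR (a, b)).1 hb
    exact ⟨Encodable.encode (b, n), (b, n), by simp, hn⟩

theorem PrimrecRel.exists_lt_of_primcodable {R : ℕ → α → Prop} (hR : PrimrecRel R) :
    PrimrecRel fun (n : ℕ) (a : α) => ∃ i < n, R i a :=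
  PrimrecPred.of_eq (hR.exists_mem_list.comp (Primrec.list_range.comp Primrec.fst) Primrec.snd)
    fun _ => by simp

theorem PrimrecRel.forall_lt_of_primcodable {R : ℕ → α → Prop} (hR : PrimrecRel R) :
    PrimrecRel fun (n : ℕ) (a : α) => ∀ i < n, R i a :=
  PrimrecPred.of_eq (hR.forall_mem_list.comp (Primrec.list_range.comp Primrec.fst) Primrec.snd)
    fun _ => by simp

theorem REPred.forall_lt {P : α → ℕ → Prop} (hP : REPred fun z : α × ℕ => P z.1 z.2)
    {f : α → ℕ} (hf : Primrec f) : REPred fun a => ∀ i < f a, P a i := by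
  obtain ⟨R, hR, hPR⟩ := hP.exists_primrecRel
  have hS : PrimrecRel fun (a : α) (m : ℕ) => ∀ i < f a, ∃ n < m, R (a, i) n := by
    have h1 : PrimrecRel fun (n : ℕ) (z : α × ℕ) => R z n := hR.comp Primrec.snd Primrec.fst
    have h2 := h1.exists_lt_of_primcodable
    have h3 : PrimrecRel fun (i : ℕ) (y : α × ℕ) => ∃ n < y.2, R (y.1, i) n :=
      h2.comp (Primrec.snd.comp Primrec.snd) ((Primrec.fst.comp Primrec.snd).pair Primrec.fst)
    exact h3.forall_lt_of_primcodable.comp (hf.comp Primrec.fst) Primrec.id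
  refine (MonotoneMachine.rePred_exists_nat hS).of_eq fun a => ⟨?_, fun h => ?_⟩
  · rintro ⟨m, h⟩ i hi
    obtain ⟨n, -, hn⟩ := h i hi
    exact (hPR (a, i)).2 ⟨n, hn⟩
  · have h' : ∀ i, ∃ n, i < f a → R (a, i) n := fun i => by
      by_cases hi : i < f a
      · exact ((hPR (a, i)).1 (h i hi)).imp fun n hn _ => hn
      · exact ⟨0, fun h => absurd h hi⟩
    choose N hN using h'
    refine ⟨∑ i ∈ Finset.range (f a), N i + 1, fun i hi => ⟨N i, ?_, hN i hi⟩⟩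
    exact Nat.lt_succ_of_le
      (Finset.single_le_sum (f := N) (fun _ _ => Nat.zero_le _) (Finset.mem_range.2 hi))

theorem Partrec₂.rePred_mem {f : α → β →. σ} (hf : Partrec₂ f) :
    REPred fun z : (α × β) × σ => z.2 ∈ f z.1.1 z.1.2 := by
  have h1 : Partrec fun z : (α × β) × σ => f z.1.1 z.1.2 :=
    hf.comp (Computable.fst.comp Computable.fst) (Computable.snd.comp Computable.fst)
  have h2 : REPred fun y : ((α × β) × σ) × σ => y.2 = y.1.2 :=
    PrimrecPred.rePred (Primrec.eq.comp Primrec.snd (Primrec.snd.comp Primrec.fst))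
  refine (h1.bind (g := fun (z : (α × β) × σ) (v : σ) =>
    Part.assert (v = z.2) fun _ => Part.some ()) h2).dom_re.of_eq fun z => ?_
  simp only [Part.bind_dom, Part.assert, Part.some_dom]
  constructor
  · rintro ⟨h, h', -⟩
    exact h' ▸ Part.get_mem h
  · intro h
    exact ⟨Part.dom_iff_mem.2 ⟨_, h⟩, Part.get_eq_of_mem h _, trivial⟩

/-- Computable uniformization: a total recursively enumerable relation contains the graph of a
computable function, found by unbounded search. -/
theorem REPred.exists_computable {P : α → β → Prop} (hP : REPred fun z : α × β => P z.1 z.2)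
    (htot : ∀ a, ∃ b, P a b) : ∃ g : α → β, Computable g ∧ ∀ a, P a (g a) := by
  classical
  obtain ⟨R, hR, hPR⟩ := hP.exists_primrecRel
  let F : α → ℕ → Option β := fun a m =>
    (Encodable.decode m : Option (β × ℕ)).bind fun z => if R (a, z.1) z.2 then some z.1 else none
  have hF : Primrec₂ F := by
    refine Primrec.option_bind (Primrec.decode.comp Primrec.snd) ?_
    refine Primrec.ite ?_ (Primrec.option_some.comp (Primrec.fst.comp Primrec.snd))
      (Primrec.const none)
    exact hR.comp ((Primrec.fst.comp Primrec.fst).pair (Primrec.fst.comp Primrec.snd))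
      (Primrec.snd.comp Primrec.snd)
  have hdom : ∀ a, (Nat.rfindOpt (F a)).Dom := fun a => by
    obtain ⟨b, hb⟩ := htot a
    obtain ⟨n, hn⟩ := (hPR (a, b)).1 hb
    exact Nat.rfindOpt_dom.2 ⟨Encodable.encode (b, n), b, by simp [F, hn]⟩
  refine ⟨fun a => (Nat.rfindOpt (F a)).get (hdom a), ?_, fun a => ?_⟩
  · exact (Partrec.rfindOpt hF.to_comp).of_eq fun a => (Part.some_get (hdom a)).symm
  · obtain ⟨m, hm⟩ := Nat.rfindOpt_spec (Part.get_mem (hdom a))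
    simp only [F, Option.mem_def, Option.bind_eq_some_iff, Option.ite_none_right_eq_some,
      Option.some.injEq] at hm
    obtain ⟨z, -, hz, hz'⟩ := hm
    have h : P a z.1 := (hPR (a, z.1)).2 ⟨_, hz⟩
    rwa [hz'] at h

/-- A nonempty recursively enumerable set is the range of a primitive recursive function. -/
theorem REPred.exists_primrec_enumeration {p : α → Prop} (hp : REPred p) (hne : ∃ a, p a) :
    ∃ g : ℕ → α, Primrec g ∧ ∀ a, p a ↔ ∃ k, g k = a := by
  classical
  obtain ⟨R, hR, hpR⟩ := hp.exists_primrecRel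
  obtain ⟨a₀, h₀⟩ := hne
  let D : ℕ → α × ℕ := fun k => (Encodable.decode k).getD (a₀, 0)
  have hD : Primrec D := Primrec.option_getD.comp Primrec.decode (Primrec.const _)
  refine ⟨fun k => if R (D k).1 (D k).2 then (D k).1 else a₀, ?_, fun a => ⟨fun h => ?_, ?_⟩⟩
  · exact Primrec.ite (hR.comp (Primrec.fst.comp hD) (Primrec.snd.comp hD))
      (Primrec.fst.comp hD) (Primrec.const a₀)
  · obtain ⟨n, hn⟩ := (hpR a).1 h
    exact ⟨Encodable.encode (a, n), by simp [D, hn]⟩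
  · rintro ⟨k, rfl⟩
    dsimp only
    split_ifs with h
    · exact (hpR _).2 ⟨_, h⟩
    · exact h₀

end Enumerable

namespace MonotoneMachine

/-! ### Prefixes of infinite sequences -/

@[simp]
lemma length_take (x : Cantor) (n : ℕ) : (x.take n).length = n := by
  simp [Cantor.take]

lemma getD_take {x : Cantor} {n i : ℕ} (h : i < n) : (x.take n).getD i false = x i := by
  simp [Cantor.take, List.getD, h]

lemma take_take (x : Cantor) {m n : ℕ} (h : m ≤ n) : (x.take n).take m = x.take m := by
  simp [Cantor.take, ← List.map_take, List.take_range, h]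

lemma take_prefix_take (x : Cantor) {m n : ℕ} (h : m ≤ n) : x.take m <+: x.take n := by
  rw [← take_take x h]
  exact List.take_prefix _ _

lemma mem_cylinder_iff_prefix {x : Cantor} {u : List Bool} {n : ℕ} (h : u.length ≤ n) :
    x ∈ cylinder u ↔ u <+: x.take n := by
  rw [List.prefix_iff_eq_take, take_take x h, eq_comm]
  rfl

lemma take_eq_take_of_mem_cylinder {x y : Cantor} {u : List Bool} (hx : x ∈ cylinder u)
    (hy : y ∈ cylinder u) {n : ℕ} (hn : n ≤ u.length) : x.take n = y.take n := by
  rw [← take_take x hn, ← take_take y hn, show x.take u.length = u from hx,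
    show y.take u.length = u from hy]

lemma cylinder_subset_of_prefix {u v : List Bool} (h : u <+: v) : cylinder v ⊆ cylinder u := by
  intro x hx
  rw [mem_cylinder_iff_prefix h.length_le, show x.take v.length = v from hx]
  exact h

/-- The infinite sequence `w000…`. -/
def zeroExtend (w : List Bool) : Cantor := fun n => w.getD n false

lemma zeroExtend_mem_cylinder (w : List Bool) : zeroExtend w ∈ cylinder w := by
  refine List.ext_getElem (by simp) fun i _ hi => ?_
  simp [Cantor.take, zeroExtend, List.getD, hi]

lemma zeroExtend_append_replicate (w : List Bool) (n : ℕ) :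
    zeroExtend (w ++ List.replicate n false) = zeroExtend w := by
  funext i
  simp only [zeroExtend, List.getD, List.getElem?_append, List.getElem?_replicate]
  split_ifs with h h' <;> simp_all

lemma primrec_zeroExtend : Primrec₂ zeroExtend := Primrec.list_getD false

lemma computable_zeroExtend (w : List Bool) : Computable (zeroExtend w) :=
  (primrec_zeroExtend.comp (Primrec.const w) Primrec.id).to_comp

/-! ### Strings of low complexity -/

/-- The string `u` has a program of length less than `|u| / 2 + c`. -/
def IsLow (M : Set (List Bool × List Bool)) (c : ℕ) (u : List Bool) : Prop :=
  ∃ z ∈ M, u <+: z.2 ∧ 2 * z.1.length < u.length + 2 * c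

variable {M : Set (List Bool × List Bool)} {c : ℕ}

lemma Km_le_of_mem {z : List Bool × List Bool} {u : List Bool} (hz : z ∈ M) (hu : u <+: z.2) :
    Km M u ≤ z.1.length :=
  iInf₂_le z ⟨hz, hu⟩

lemma exists_mem_length_le_of_Km_le {u : List Bool} {n : ℕ} (h : Km M u ≤ n) :
    ∃ z ∈ M, u <+: z.2 ∧ z.1.length ≤ n := by
  have h' : Km M u < (n + 1 : ℕ) := h.trans_lt (by exact_mod_cast n.lt_succ_self)
  simp only [Km, iInf_lt_iff] at h'
  obtain ⟨z, ⟨hz, hu⟩, hlt⟩ := h'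
  exact ⟨z, hz, hu, Nat.lt_succ_iff.1 (by exact_mod_cast hlt)⟩

lemma natCast_lt_half_add_iff {k n : ℕ} :
    (k : ℝ≥0∞) < (n : ℝ≥0∞) / 2 + (c : ℝ≥0∞) ↔ 2 * k < n + 2 * c := by
  have h : (n : ℝ≥0∞) / 2 + (c : ℝ≥0∞) = ((n + 2 * c : ℕ) : ℝ≥0∞) / 2 := by
    push_cast
    rw [ENNReal.add_div, mul_comm, ENNReal.mul_div_cancel_right] <;> simp
  rw [h, ENNReal.lt_div_iff_mul_lt (by simp) (by simp), mul_comm]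
  exact_mod_cast Iff.rfl

lemma Km_lt_half_add_iff {u : List Bool} :
    (Km M u : ℝ≥0∞) < (u.length : ℝ≥0∞) / 2 + (c : ℝ≥0∞) ↔ IsLow M c u := by
  constructor
  · intro h
    have hne : Km M u ≠ ⊤ := by
      intro htop
      simp [htop] at h
    obtain ⟨k, hk⟩ := ENat.ne_top_iff_exists.1 hne
    obtain ⟨z, hz, hu, hle⟩ := exists_mem_length_le_of_Km_le hk.ge
    rw [← hk, ENat.toENNReal_coe, natCast_lt_half_add_iff] at h
    exact ⟨z, hz, hu, by omega⟩
  · rintro ⟨z, hz, hu, hlt⟩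
    refine lt_of_le_of_lt ?_ (natCast_lt_half_add_iff.2 hlt)
    exact_mod_cast ENat.toENNReal_le.2 (Km_le_of_mem hz hu)

lemma mem_lowComplexitySet_iff {x : ComputableCantor} :
    x ∈ lowComplexitySet M c ↔ ∀ n, IsLow M c (x.1.take n) := by
  refine forall_congr' fun n => ?_
  rw [← Km_lt_half_add_iff, length_take]

lemma rePred_isLow (hM : IsMonotoneMachine M) (c : ℕ) : REPred (IsLow M c) := by
  refine REPred.exists (P := fun u z => z ∈ M ∧ u <+: z.2 ∧ 2 * z.1.length < u.length + 2 * c)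
    ((hM.re.comp Computable.snd).and (PrimrecPred.rePred (PrimrecPred.and ?_ ?_)))
  · exact prefix_primrec.comp Primrec.fst (Primrec.snd.comp Primrec.snd)
  · exact Primrec.nat_lt.comp
      (Primrec.nat_mul.comp (Primrec.const 2)
        (Primrec.list_length.comp (Primrec.fst.comp Primrec.snd)))
      (Primrec.nat_add.comp (Primrec.list_length.comp Primrec.fst) (Primrec.const (2 * c)))

/-! ### Uniformly computed sequences have low complexity -/

/-- The strings `u` which are a prefix of the sequence computed by `f e`. -/
def IsComputedPrefix (f : ℕ → ℕ →. Bool) (e : ℕ) (u : List Bool) : Prop :=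
  ∀ i < u.length, u.getD i false ∈ f e i

lemma rePred_isComputedPrefix {f : ℕ → ℕ →. Bool} (hf : Partrec₂ f) :
    REPred fun z : ℕ × List Bool => IsComputedPrefix f z.1 z.2 := by
  refine REPred.forall_lt (P := fun (z : ℕ × List Bool) i => z.2.getD i false ∈ f z.1 i) ?_
    (Primrec.list_length.comp Primrec.snd)
  refine hf.rePred_mem.comp (f := fun y : (ℕ × List Bool) × ℕ =>
    ((y.1.1, y.2), y.1.2.getD y.2 false)) (Primrec.to_comp ?_)
  exact ((Primrec.fst.comp Primrec.fst).pair Primrec.snd).pair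
    ((Primrec.list_getD false).comp (Primrec.snd.comp Primrec.fst) Primrec.snd)

lemma isComputedPrefix_take {f : ℕ → ℕ →. Bool} {e : ℕ} {x : Cantor} (hx : ∀ n, x n ∈ f e n)
    (k : ℕ) : IsComputedPrefix f e (x.take k) := by
  intro i hi
  rw [getD_take (by simpa using hi)]
  exact hx i

lemma IsComputedPrefix.prefix_or_prefix {f : ℕ → ℕ →. Bool} {e : ℕ} {u v : List Bool}
    (hu : IsComputedPrefix f e u) (hv : IsComputedPrefix f e v) : u <+: v ∨ v <+: u := by
  have key : ∀ u v : List Bool, IsComputedPrefix f e u → IsComputedPrefix f e v →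
      u.length ≤ v.length → u <+: v := by
    intro u v hu hv h
    refine List.prefix_iff_getElem.2 ⟨h, fun i hi => ?_⟩
    have := Part.mem_unique (hu i hi) (hv i (hi.trans_le h))
    simpa [List.getD, hi, hi.trans_le h] using this
  rcases le_total u.length v.length with h | h
  · exact Or.inl (key u v hu hv h)
  · exact Or.inr (key v u hv hu h)

lemma primrec_replicate_false : Primrec fun e : ℕ => List.replicate e false :=
  (Primrec.list_map Primrec.list_range (Primrec₂.const false)).of_eq fun e => by simp

/-- If the sequences `f e` are uniformly computable, then all prefixes of the `e`-th one have
complexity at most `e + d`, since `0ᵉ1` may serve as a program for that sequence. -/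
lemma exists_program (hM : IsOptimalMonotoneMachine M) {f : ℕ → ℕ →. Bool} (hf : Partrec₂ f) :
    ∃ d, ∀ e (x : Cantor), (∀ n, x n ∈ f e n) →
      ∀ k, ∃ z ∈ M, x.take k <+: z.2 ∧ z.1.length ≤ e + d := by
  let N : Set (List Bool × List Bool) :=
    {z | ∃ e, z.1 = List.replicate e false ++ [true] ∧ IsComputedPrefix f e z.2}
  have hN : IsMonotoneMachine N := by
    refine ⟨?_, ?_⟩
    · refine REPred.exists (P := fun (z : List Bool × List Bool) e =>
        z.1 = List.replicate e false ++ [true] ∧ IsComputedPrefix f e z.2) (REPred.and ?_ ?_)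
      · exact PrimrecPred.rePred (Primrec.eq.comp (Primrec.fst.comp Primrec.fst)
          (Primrec.list_append.comp (primrec_replicate_false.comp Primrec.snd)
            (Primrec.const [true])))
      · exact (rePred_isComputedPrefix hf).comp
          (f := fun y : (List Bool × List Bool) × ℕ => (y.2, y.1.2))
          (Computable.snd.pair (Computable.snd.comp Computable.fst))
    · rintro p q u v ⟨e, rfl, hu⟩ ⟨e', rfl, hv⟩ hpq
      obtain ⟨rfl, -⟩ := replicate_prefix hpq
      exact hu.prefix_or_prefix hv
  obtain ⟨d, hd⟩ := hM.optimal N hN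
  refine ⟨d + 1, fun e x hx k => exists_mem_length_le_of_Km_le ((hd _).trans ?_)⟩
  refine (add_le_add_left (Km_le_of_mem (M := N) (z := (List.replicate e false ++ [true], x.take k))
    ⟨e, rfl, isComputedPrefix_take hx k⟩ (List.prefix_refl _)) (d : ℕ∞)).trans (le_of_eq ?_)
  simp only [List.length_append, List.length_replicate, List.length_singleton]
  push_cast
  ring

/-- Membership in `lowComplexitySet M c` is semidecidable from an index of the sequence: the index
bounds the complexity of all prefixes, so that only finitely many of them need to be examined. -/
lemma exists_rePred_forall_isLow (hM : IsOptimalMonotoneMachine M) (c : ℕ) {f : ℕ → ℕ →. Bool}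
    (hf : Partrec₂ f) : ∃ H : ℕ → Prop, REPred H ∧
      ∀ e (x : Cantor), (∀ n, x n ∈ f e n) → (H e ↔ ∀ n, IsLow M c (x.take n)) := by
  obtain ⟨d, hd⟩ := exists_program hM hf
  refine ⟨fun e => ∀ n < 2 * (e + d) + 1, ∃ u : List Bool,
    u.length = n ∧ IsComputedPrefix f e u ∧ IsLow M c u, ?_, fun e x hx => ?_⟩
  · refine REPred.forall_lt (P := fun e n => ∃ u : List Bool,
      u.length = n ∧ IsComputedPrefix f e u ∧ IsLow M c u) (REPred.exists
        (P := fun (y : ℕ × ℕ) (u : List Bool) =>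
          u.length = y.2 ∧ IsComputedPrefix f y.1 u ∧ IsLow M c u) ?_) ?_
    · refine REPred.and (PrimrecPred.rePred ?_) (REPred.and ?_ ?_)
      · exact Primrec.eq.comp (Primrec.list_length.comp Primrec.snd)
          (Primrec.snd.comp Primrec.fst)
      · exact (rePred_isComputedPrefix hf).comp (f := fun y : (ℕ × ℕ) × List Bool => (y.1.1, y.2))
          ((Computable.fst.comp Computable.fst).pair Computable.snd)
      · exact (rePred_isLow hM.monotone c).comp Computable.snd
    · exact Primrec.succ.comp (Primrec.nat_mul.comp (Primrec.const 2)
        (Primrec.nat_add.comp Primrec.id (Primrec.const d)))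
  · constructor
    · intro h n
      by_cases hn : n < 2 * (e + d) + 1
      · obtain ⟨u, hu, hfu, hlow⟩ := h n hn
        have hp : x.take n = u := by
          rcases hfu.prefix_or_prefix (isComputedPrefix_take hx n) with h | h
          · exact (h.eq_of_length (by simp [hu])).symm
          · exact h.eq_of_length (by simp [hu])
        rwa [hp]
      · obtain ⟨z, hz, hxz, hle⟩ := hd e x hx n
        exact ⟨z, hz, hxz, by rw [length_take]; omega⟩
    · exact fun h n _ => ⟨x.take n, by simp, isComputedPrefix_take hx n, h n⟩

theorem markovSemidecidable_lowComplexitySet (hM : IsOptimalMonotoneMachine M) (c : ℕ) :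
    MarkovSemidecidable (lowComplexitySet M c) := by
  let f : ℕ → ℕ →. Bool := fun e n =>
    ((Denumerable.ofNat Nat.Partrec.Code e).eval n).map fun b => decide (b = 1)
  have hf : Partrec₂ f := by
    refine Partrec.map (Nat.Partrec.Code.eval_part.comp
      ((Computable.ofNat _).comp Computable.fst) Computable.snd) ?_
    exact (Primrec.eq.comp Primrec.snd (Primrec.const 1)).decide.to_comp
  obtain ⟨H, hH, hHx⟩ := exists_rePred_forall_isLow hM c hf
  refine ⟨fun e => H (Encodable.encode e), hH.comp Computable.encode, fun x e he => ?_⟩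
  rw [mem_lowComplexitySet_iff]
  refine hHx _ _ fun n => ?_
  have hn := he n
  simp only [f, Denumerable.ofNat_encode, hn, Part.map_some, Part.mem_some_iff]
  cases x.1 n <;> rfl

/-- The strings `w` such that `w000…` belongs to `lowComplexitySet M c`. -/
def IsLowExtendable (M : Set (List Bool × List Bool)) (c : ℕ) (w : List Bool) : Prop :=
  ∀ n, IsLow M c ((zeroExtend w).take n)

lemma rePred_isLowExtendable (hM : IsOptimalMonotoneMachine M) (c : ℕ) :
    REPred (IsLowExtendable M c) := by
  let f : ℕ → ℕ →. Bool := fun e n =>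
    Part.some (zeroExtend ((Encodable.decode e : Option (List Bool)).getD []) n)
  have hf : Partrec₂ f := (primrec_zeroExtend.comp
    (Primrec.option_getD.comp (Primrec.decode.comp Primrec.fst) (Primrec.const []))
    Primrec.snd).to_comp.partrec
  obtain ⟨H, hH, hHx⟩ := exists_rePred_forall_isLow hM c hf
  refine (hH.comp (Computable.encode (α := List Bool))).of_eq fun w => ?_
  exact hHx _ _ fun n => by simp [f]

/-! ### Nonemptiness, closedness and empty interior -/

lemma isLowExtendable_iff {w : List Bool} :
    IsLowExtendable M c w ↔
      (⟨zeroExtend w, computable_zeroExtend w⟩ : ComputableCantor) ∈ lowComplexitySet M c :=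
  (mem_lowComplexitySet_iff (x := ⟨zeroExtend w, computable_zeroExtend w⟩)).symm

lemma exists_forall_isLowExtendable_nil (hM : IsOptimalMonotoneMachine M) :
    ∃ c₀, ∀ c, c₀ ≤ c → IsLowExtendable M c [] := by
  obtain ⟨d, hd⟩ := exists_program hM (f := fun _ _ => Part.some false)
    (Computable.const false).partrec
  refine ⟨d + 1, fun c hc n => ?_⟩
  obtain ⟨z, hz, hu, hle⟩ := hd 0 (zeroExtend []) (fun n => by simp [zeroExtend]) n
  exact ⟨z, hz, hu, by omega⟩

lemma isOpen_cylinder (u : List Bool) : IsOpen (cylinder u) := by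
  have h : cylinder u =
      ⋂ i ∈ Finset.range u.length, (fun x : Cantor => x i) ⁻¹' {u.getD i false} := by
    ext x
    simp only [cylinder, Set.mem_ofPred_eq, Set.mem_iInter, Finset.mem_range, Set.mem_preimage,
      Set.mem_singleton_iff]
    constructor
    · intro hx i hi
      rw [← hx, getD_take hi]
    · intro hx
      refine List.ext_getElem (by simp) fun i _ hi => ?_
      simpa [Cantor.take, List.getD, hi] using hx i hi
  rw [h]
  exact isOpen_biInter_finset fun i _ => (isOpen_discrete _).preimage (continuous_apply i)

lemma exists_cylinder_subset {O : Set Cantor} (hO : IsOpen O) {x : Cantor} (hx : x ∈ O) :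
    ∃ n, cylinder (x.take n) ⊆ O := by
  obtain ⟨_, ⟨y, n, rfl⟩, hxy, hsub⟩ :=
    (PiNat.isTopologicalBasis_cylinders (E := fun _ => Bool)).exists_subset_of_mem_open hx hO
  refine ⟨n, fun z hz => hsub fun i hi => ?_⟩
  have hz' : z.take n = x.take n := by simpa [cylinder] using hz
  have hzx : z i = x i := by rw [← getD_take (x := z) hi, hz', getD_take hi]
  exact hzx.trans (hxy i hi)

lemma isClosed_lowComplexitySet (M : Set (List Bool × List Bool)) (c : ℕ) :
    IsClosed (lowComplexitySet M c) := by
  rw [← isOpen_compl_iff, isOpen_iff_forall_mem_open]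
  intro x hx
  simp only [Set.mem_compl_iff, mem_lowComplexitySet_iff, not_forall] at hx
  obtain ⟨n, hn⟩ := hx
  refine ⟨Subtype.val ⁻¹' cylinder (x.1.take n), fun y hy hyA => hn ?_,
    (isOpen_cylinder _).preimage continuous_subtype_val, ?_⟩
  · have hy' : y.1.take n = x.1.take n := by simpa [cylinder] using hy
    exact hy' ▸ mem_lowComplexitySet_iff.1 hyA n
  · simp [cylinder]

/-- Distinct strings of the same length have distinct programs, so that the strings of low
complexity are too few to fill a cylinder. -/
lemma exists_not_isLow (hM : IsMonotoneMachine M) (c : ℕ) (u : List Bool) :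
    ∃ w, u <+: w ∧ ¬ IsLow M c w := by
  by_contra! h
  -- With `|u| + 2c = a`, extensions by `2 (a + 2) + a` bits have programs of length
  -- at most `L = 2a + 2`.
  set a := u.length + 2 * c with ha
  set k := 2 * (a + 2) + a with hk
  set L := 2 * a + 2 with hL
  have hp : ∀ b : Fin k → Bool, ∃ z ∈ M, u ++ List.ofFn b <+: z.2 ∧ z.1.length ≤ L := by
    intro b
    obtain ⟨z, hz, hu, hlt⟩ := h (u ++ List.ofFn b) (List.prefix_append _ _)
    refine ⟨z, hz, hu, ?_⟩
    simp only [List.length_append, List.length_ofFn] at hlt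
    omega
  choose z hz hu hlen using hp
  let F : (Fin k → Bool) → Fin (L + 1) × (Fin L → Bool) := fun b =>
    (⟨(z b).1.length, Nat.lt_succ_of_le (hlen b)⟩, fun i => (z b).1.getD i false)
  have hF : Function.Injective F := by
    intro b b' hbb
    simp only [F, Prod.mk.injEq, Fin.mk.injEq] at hbb
    have hprog : (z b).1 = (z b').1 := by
      refine List.ext_getElem hbb.1 fun i hi hi' => ?_
      simpa [List.getD, hi, hi'] using congrFun hbb.2 ⟨i, hi.trans_le (hlen b)⟩
    have hout : ∃ v, u ++ List.ofFn b <+: v ∧ u ++ List.ofFn b' <+: v := by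
      rcases hM.compat _ _ _ _ (hz b) (hz b') (hprog ▸ List.prefix_refl _) with h | h
      · exact ⟨_, (hu b).trans h, hu b'⟩
      · exact ⟨_, hu b, (hu b').trans h⟩
    obtain ⟨v, hv, hv'⟩ := hout
    have heq := (List.prefix_of_prefix_length_le hv hv' (by simp)).eq_of_length (by simp)
    exact List.ofFn_injective (List.append_cancel_left heq)
  have hcard := Fintype.card_le_of_injective F hF
  simp only [Fintype.card_pi, Fintype.card_bool, Finset.prod_const, Finset.card_univ,
    Fintype.card_fin, Fintype.card_prod] at hcard
  have hkL : k = a + 2 + L := by omega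
  rw [hkL, pow_add] at hcard
  have h1 := Nat.le_of_mul_le_mul_right hcard (by positivity)
  have h2 : a + 1 ≤ 2 ^ a := Nat.lt_two_pow_self
  rw [pow_add] at h1
  omega

lemma exists_not_isLowExtendable (hM : IsMonotoneMachine M) (c : ℕ) (u : List Bool) :
    ∃ w, u <+: w ∧ ¬ IsLowExtendable M c w := by
  obtain ⟨w, huw, hw⟩ := exists_not_isLow hM c u
  refine ⟨w, huw, fun h => hw ?_⟩
  have := h w.length
  rwa [show (zeroExtend w).take w.length = w from zeroExtend_mem_cylinder w] at this

lemma interior_lowComplexitySet (hM : IsMonotoneMachine M) (c : ℕ) :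
    interior (lowComplexitySet M c) = ∅ := by
  refine Set.eq_empty_iff_forall_notMem.2 fun x hx => ?_
  obtain ⟨O, hO, hOA⟩ := isOpen_induced_iff.1 (isOpen_interior (s := lowComplexitySet M c))
  obtain ⟨n, hn⟩ := exists_cylinder_subset hO (x := x.1) (by rw [← hOA] at hx; exact hx)
  obtain ⟨w, hw, hwA⟩ := exists_not_isLowExtendable hM c (x.1.take n)
  refine hwA (isLowExtendable_iff.2 (interior_subset ?_))
  rw [← hOA]
  exact hn (cylinder_subset_of_prefix hw (zeroExtend_mem_cylinder w))

/-! ### Effectively open sets around points of low complexity -/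

/-- Let `w000…` have low complexity, and let the effectively open set generated by `W` contain
all computable points of `[w]` which do not. Then it also contains a point of `[w]` of low
complexity: for each `j`, search for an extension of `w` followed by `4j` zeros which enters the
open set. The prefixes of the resulting sequences are those of `w000…` up to length `4j`, and
have complexity at most `j + O(1)` beyond. -/
lemma exists_isLowExtendable_of_compl_subset (hM : IsOptimalMonotoneMachine M)
    {W : List Bool → Prop} (hW : REPred W) {w : List Bool} (hw : IsLowExtendable M c w)
    (hcompl : ∀ y : ComputableCantor, y.1 ∈ cylinder w → y ∉ lowComplexitySet M c →
      ∃ v, W v ∧ y.1 ∈ cylinder v) :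
    ∃ w', w <+: w' ∧ IsLowExtendable M c w' ∧ ∃ v, W v ∧ v <+: w' := by
  let P : ℕ → List Bool → Prop := fun j w' =>
    w ++ List.replicate (4 * j) false <+: w' ∧ ∃ v, W v ∧ v <+: w'
  have hP : REPred fun z : ℕ × List Bool => P z.1 z.2 := by
    refine REPred.and (PrimrecPred.rePred ?_) (REPred.exists
      (P := fun (z : ℕ × List Bool) v => W v ∧ v <+: z.2)
      ((hW.comp Computable.snd).and (PrimrecPred.rePred ?_)))
    · exact prefix_primrec.comp (Primrec.list_append.comp (Primrec.const w)
        (primrec_replicate_false.comp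
          (Primrec.nat_mul.comp (Primrec.const 4) Primrec.fst))) Primrec.snd
    · exact prefix_primrec.comp Primrec.snd (Primrec.snd.comp Primrec.fst)
  have htot : ∀ j, ∃ w', P j w' := by
    intro j
    obtain ⟨w', hw', hw'A⟩ :=
      exists_not_isLowExtendable hM.monotone c (w ++ List.replicate (4 * j) false)
    obtain ⟨v, hv, hvw'⟩ := hcompl ⟨zeroExtend w', computable_zeroExtend w'⟩
      (cylinder_subset_of_prefix ((List.prefix_append _ _).trans hw')
        (zeroExtend_mem_cylinder w'))
      (fun h => hw'A (isLowExtendable_iff.2 h))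
    refine ⟨(zeroExtend w').take (max w'.length v.length), hw'.trans ?_, v, hv, ?_⟩
    · exact (mem_cylinder_iff_prefix (le_max_left _ _)).1 (zeroExtend_mem_cylinder w')
    · exact (mem_cylinder_iff_prefix (le_max_right _ _)).1 hvw'
  obtain ⟨g, hg, hgP⟩ := hP.exists_computable htot
  have hf : Partrec₂ fun e n => Part.some (zeroExtend (g e) n) :=
    (primrec_zeroExtend.to_comp.comp (hg.comp Computable.fst) Computable.snd).partrec
  obtain ⟨d, hd⟩ := exists_program hM hf
  obtain ⟨hwg, hv⟩ := hgP (d + 1)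
  refine ⟨g (d + 1), (List.prefix_append _ _).trans hwg, fun n => ?_, hv⟩
  rcases le_or_gt n (w ++ List.replicate (4 * (d + 1)) false).length with hn | hn
  · have h := zeroExtend_mem_cylinder (w ++ List.replicate (4 * (d + 1)) false)
    rw [zeroExtend_append_replicate] at h
    rw [take_eq_take_of_mem_cylinder
      (cylinder_subset_of_prefix hwg (zeroExtend_mem_cylinder _)) h hn]
    exact hw n
  · obtain ⟨z, hz, hu, hle⟩ := hd (d + 1) (zeroExtend (g (d + 1))) (fun _ => by simp) n
    refine ⟨z, hz, hu, ?_⟩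
    simp only [List.length_append, List.length_replicate] at hn
    rw [length_take]
    omega

/-! ### The effective Baire category argument -/

lemma IsLowExtendable.append_false {w : List Bool} (h : IsLowExtendable M c w) :
    IsLowExtendable M c (w ++ [false]) := by
  rw [IsLowExtendable, show [false] = List.replicate 1 false from rfl,
    zeroExtend_append_replicate]
  exact h

/-- A computable sequence of strictly increasing strings has a computable limit. -/
lemma exists_computable_limit {w : ℕ → List Bool} (hw : Computable w)
    (hmono : ∀ s, w s <+: w (s + 1)) (hlen : ∀ s, (w s).length < (w (s + 1)).length) :
    ∃ x : ComputableCantor, ∀ s, x.1 ∈ cylinder (w s) ∧ s ≤ (w s).length := by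
  have hle : ∀ s, s ≤ (w s).length := fun s => by
    induction s with
    | zero => exact Nat.zero_le _
    | succ s ih => exact Nat.succ_le_of_lt (ih.trans_lt (hlen s))
  have hpre : ∀ s t, s ≤ t → w s <+: w t := fun s t hst => by
    induction t, hst using Nat.le_induction with
    | base => exact List.prefix_refl _
    | succ t _ ih => exact ih.trans (hmono t)
  refine ⟨⟨fun n => (w (n + 1)).getD n false, ?_⟩, fun s => ⟨?_, hle s⟩⟩
  · exact (Primrec.list_getD false).to_comp.comp (hw.comp Computable.succ) Computable.id
  · refine List.ext_getElem (by simp) fun i _ hi => ?_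
    have hi' : i < (w (i + 1)).length := hle (i + 1)
    simp only [Cantor.take, List.getElem_map, List.getElem_range, List.getD, hi',
      List.getElem?_eq_getElem, Option.getD_some]
    rcases le_total (i + 1) s with h | h
    · exact (hpre _ _ h).getElem hi'
    · exact ((hpre _ _ h).getElem hi).symm

theorem not_isSigma02OnComputable_lowComplexitySet (hM : IsOptimalMonotoneMachine M)
    (hne : ∃ w, IsLowExtendable M c w) :
    ¬ IsSigma02OnComputable (lowComplexitySet M c) := by
  rintro ⟨S, ⟨U, V, ⟨WU, hWU, hU⟩, ⟨WV, hWV, hV⟩, rfl⟩, hA⟩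
  have hA' : ∀ x : ComputableCantor, x ∈ lowComplexitySet M c ↔ ∃ i, x.1 ∈ U i ∧ x.1 ∉ V i := by
    intro x
    rw [hA]
    simp
  obtain ⟨g, hg, hgD⟩ := (rePred_isLowExtendable hM c).exists_primrec_enumeration hne
  obtain ⟨R, hR, hWR⟩ := hWU.exists_primrecRel
  -- At stage `s = ⟨i, t⟩`, the cylinder of `u` is seen to lie inside `U i` within time `t`.
  let C : List Bool → ℕ → Prop := fun u s =>
    ∃ l < s.unpair.2, ∃ τ < s.unpair.2, R (s.unpair.1, u.take l) τ
  have hC : PrimrecRel C := by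
    have h1 : PrimrecRel fun (τ : ℕ) (y : ℕ × List Bool) => R y τ :=
      hR.comp Primrec.snd Primrec.fst
    have h2 : PrimrecRel fun (l : ℕ) (y : List Bool × ℕ) =>
        ∃ τ < y.2.unpair.2, R (y.2.unpair.1, y.1.take l) τ := by
      have hs : Primrec fun a : ℕ × (List Bool × ℕ) => a.2.2.unpair :=
        Primrec.unpair.comp (Primrec.snd.comp Primrec.snd)
      exact h1.exists_lt_of_primcodable.comp (Primrec.snd.comp hs)
        ((Primrec.fst.comp hs).pair
          (Primrec.list_take.comp Primrec.fst (Primrec.fst.comp Primrec.snd)))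
    exact h2.exists_lt_of_primcodable.comp
      (Primrec.snd.comp (Primrec.unpair.comp Primrec.snd)) Primrec.id
  have hCU : ∀ u s, C u s → cylinder u ⊆ U s.unpair.1 := by
    rintro u s ⟨l, -, τ, -, hR⟩ x hx
    rw [hU]
    exact ⟨u.take l, (hWR _).2 ⟨τ, hR⟩,
      cylinder_subset_of_prefix (List.take_prefix l u) hx⟩
  let P : ℕ × ℕ → ℕ → Prop := fun y k =>
    g y.1 <+: g k ∧ (g y.1).length < (g k).length ∧
      (¬ C (g y.1) y.2 ∨ ∃ v, WV (y.2.unpair.1, v) ∧ v <+: g k)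
  have hP : REPred fun z : (ℕ × ℕ) × ℕ => P z.1 z.2 := by
    have h1 : Primrec fun z : (ℕ × ℕ) × ℕ => g z.1.1 :=
      hg.comp (Primrec.fst.comp Primrec.fst)
    have h2 : Primrec fun z : (ℕ × ℕ) × ℕ => g z.2 := hg.comp Primrec.snd
    have hs : Primrec fun z : (ℕ × ℕ) × ℕ => z.1.2 := Primrec.snd.comp Primrec.fst
    refine (PrimrecPred.rePred (prefix_primrec.comp h1 h2)).and ((PrimrecPred.rePred
      (Primrec.nat_lt.comp (Primrec.list_length.comp h1) (Primrec.list_length.comp h2))).and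
      ((PrimrecPred.rePred (PrimrecPred.not (hC.comp h1 hs))).or (REPred.exists
        (P := fun (z : (ℕ × ℕ) × ℕ) v => WV (z.1.2.unpair.1, v) ∧ v <+: g z.2)
        (REPred.and ?_ (PrimrecPred.rePred ?_)))))
    · exact hWV.comp (Primrec.pair (Primrec.fst.comp (Primrec.unpair.comp
        (hs.comp Primrec.fst))) Primrec.snd).to_comp
    · exact prefix_primrec.comp Primrec.snd (h2.comp Primrec.fst)
  have htot : ∀ y, ∃ k, P y k := by
    rintro ⟨m, s⟩
    have hm : IsLowExtendable M c (g m) := (hgD _).2 ⟨m, rfl⟩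
    by_cases hCm : C (g m) s
    · -- The points of the cylinder outside `V i` lie in `U i \ V i`, hence have low complexity.
      obtain ⟨w', hw', hlow, v, hv, hvw'⟩ := exists_isLowExtendable_of_compl_subset hM
        (W := fun v => WV (s.unpair.1, v))
        (hWV.comp ((Computable.const s.unpair.1).pair Computable.id)) hm fun y hy hyA => by
          have hyV : y.1 ∈ V s.unpair.1 := by
            by_contra hyV
            exact hyA ((hA' y).2 ⟨_, hCU _ _ hCm hy, hyV⟩)
          rwa [hV] at hyV
      obtain ⟨k, hk⟩ := (hgD _).1 hlow.append_false
      have hw'k : w' <+: g k := hk ▸ List.prefix_append _ _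
      refine ⟨k, hw'.trans hw'k, ?_, Or.inr ⟨v, hv, hvw'.trans hw'k⟩⟩
      rw [hk, List.length_append]
      exact Nat.lt_succ_of_le hw'.length_le
    · obtain ⟨k, hk⟩ := (hgD _).1 hm.append_false
      exact ⟨k, hk ▸ List.prefix_append _ _, by simp [hk], Or.inl hCm⟩
  obtain ⟨G, hG, hGP⟩ := hP.exists_computable htot
  let m : ℕ → ℕ := fun s => Nat.rec 0 (fun s k => G (k, s)) s
  have hm : Computable m := Computable.nat_rec (h := fun _ (p : ℕ × ℕ) => G (p.2, p.1))
    Computable.id (Computable.const 0)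
    (hG.comp ((Computable.snd.comp Computable.snd).pair (Computable.fst.comp Computable.snd)))
  have hstep : ∀ s, P (m s, s) (m (s + 1)) := fun s => hGP (m s, s)
  obtain ⟨x, hx⟩ := exists_computable_limit (hg.to_comp.comp hm)
    (fun s => (hstep s).1) (fun s => (hstep s).2.1)
  have hxA : x ∈ lowComplexitySet M c := by
    refine mem_lowComplexitySet_iff.2 fun n => ?_
    rw [take_eq_take_of_mem_cylinder (hx n).1 (zeroExtend_mem_cylinder _) (hx n).2]
    exact (hgD _).2 ⟨m n, rfl⟩ n
  obtain ⟨i, hxU, hxV⟩ := (hA' x).1 hxA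
  rw [hU] at hxU
  obtain ⟨u, hu, hxu⟩ := hxU
  obtain ⟨τ, hτ⟩ := (hWR _).1 hu
  -- A late stage devoted to `i` notices that `x` is in `U i`, and moves into `V i`.
  set t := max u.length τ + 1 with ht
  have hts : u.length ≤ (g (m (Nat.pair i t))).length :=
    ((le_max_left _ _).trans (Nat.le_succ _)).trans ((Nat.right_le_pair i t).trans (hx _).2)
  have hCs : C (g (m (Nat.pair i t))) (Nat.pair i t) := by
    refine ⟨u.length, ?_, τ, ?_, ?_⟩
    · simp [ht]
    · simp [ht]
    · have hpre : u <+: g (m (Nat.pair i t)) := by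
        rw [← show x.1.take _ = g (m (Nat.pair i t)) from (hx (Nat.pair i t)).1]
        exact (mem_cylinder_iff_prefix hts).1 hxu
      rw [Nat.unpair_pair, ← List.prefix_iff_eq_take.1 hpre]
      exact hτ
  rcases (hstep (Nat.pair i t)).2.2 with h | ⟨v, hv, hvg⟩
  · exact h hCs
  · refine hxV ?_
    rw [hV]
    exact ⟨v, by simpa using hv, cylinder_subset_of_prefix hvg (hx (Nat.pair i t + 1)).1⟩

end MonotoneMachine

theorem mainTheorem5 (M : Set (List Bool × List Bool)) (hM : IsOptimalMonotoneMachine M) :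
    ∃ c₀ : ℕ, ∀ c : ℕ, c₀ ≤ c →
      MarkovSemidecidable (lowComplexitySet M c) ∧
      (lowComplexitySet M c).Nonempty ∧
      IsClosed (lowComplexitySet M c) ∧
      interior (lowComplexitySet M c) = ∅ ∧
      ¬ IsSigma02OnComputable (lowComplexitySet M c) := by
  obtain ⟨c₀, hc₀⟩ := MonotoneMachine.exists_forall_isLowExtendable_nil hM
  exact ⟨c₀, fun c hc => ⟨MonotoneMachine.markovSemidecidable_lowComplexitySet hM c,
    ⟨_, MonotoneMachine.isLowExtendable_iff.1 (hc₀ c hc)⟩,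
    MonotoneMachine.isClosed_lowComplexitySet M c,
    MonotoneMachine.interior_lowComplexitySet hM.monotone c,
    MonotoneMachine.not_isSigma02OnComputable_lowComplexitySet hM ⟨[], hc₀ c hc⟩⟩⟩
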